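/- Let $p$ be a prime and let $X$ be a noetherian normal scheme of characteristic $p$ which is $F$-finite, i.e. $F_*\mathcal O_X$ is a finitely generated $\mathcal O_X$-module, where $F\colon X\to X$ is the absolute Frobenius. For an integral noetherian normal scheme $Y$ of characteristic $p$ and an effective $\mathbb R$-divisor $\Delta$ on $Y$, the pair $(Y,\Delta)$ is called globally $F$-split if for every integer $e>0$ the natural map $$\mathcal O_Y\xrightarrow{F^e}F^e_*\mathcal O_Y\hookrightarrow F^e_*\mathcal O_Y(\lfloor (p^e-1)\Delta\rfloor)$$ splits as a homomorphism of $\mathcal O_Y$-modules. For an effective $\mathbb R$-divisor $\Delta$ on $X$, the pair $(X,\Delta)$ is called $F$-pure if $(\operatorname{Spec}\mathcal O_{X,x},\Delta|_{\operatorname{Spec}\mathcal O_{X,x}})$ is globally $F$-split for every point $x\in X$. For effective $\mathbb R$-divisors $\Delta$ and $D$ on $X$, the $F$-pure threshold of $(X,\Delta)$ with respect to $D$ is $$\mathrm{fpt}(X,\Delta;D):=\sup\{t\in\mathbb R_{\ge 0}\mid (X,\Delta+tD)\text{ is }F\text{-pure}\}\in[0,\infty].$$ Proposition. Let $\Delta$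 be an (effective) $\mathbb R$-divisor on $X$ such that $(X,\Delta)$ is $F$-pure, let $D$ be an effective $\mathbb R$-divisor on $X$, and let $c=\mathrm{fpt}(X,\Delta;D)$. Then $c<\infty$ if $D\neq 0$, and $(X,\Delta+cD)$ is $F$-pure, where $cD:=0$ if $D=0$. -/

import Mathlib

open AlgebraicGeometry CategoryTheory
open scoped NNReal ENNReal

universe u

noncomputable section

namespace FSing

/-- A scheme is normal if all its local rings are integrally closed domains. -/
class IsNormalScheme (X : Scheme.{u}) : Prop where
  isDomain_stalk (X) : ∀ x : X, IsDomain (X.presheaf.stalk x)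
  isIntegrallyClosed_stalk (X) : ∀ x : X, IsIntegrallyClosed (X.presheaf.stalk x)

attribute [instance] IsNormalScheme.isDomain_stalk IsNormalScheme.isIntegrallyClosed_stalk

/-- A scheme has characteristic `p` if `X ⟶ Spec ℤ` factors through `Spec (ℤ/p)`, that is,
if `p = 0` in the ring of global functions. -/
def IsOfCharacteristic (p : ℕ) (X : Scheme.{u}) : Prop :=
  (p : Γ(X, ⊤)) = 0

/-- A scheme of characteristic `p` is `F`-finite if `F_* 𝒪_X` is a finitely generated
`𝒪_X`-module for the absolute Frobenius `F`. As `F` is the identity on the underlying space and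
`f ↦ f ^ p` on sections, this says that the `p`-power ring endomorphism of `Γ(X, U)` is finite
for every affine open `U`. -/
def IsFFinite (p : ℕ) (X : Scheme.{u}) : Prop :=
  ∀ U : X.Opens, IsAffineOpen U →
    ∃ F : Γ(X, U) →+* Γ(X, U), (∀ f, F f = f ^ p) ∧ F.Finite

/-- The prime divisors of `X`, given by their generic points: the points of codimension one. -/
abbrev PrimeDivisor (X : Scheme.{u}) : Type u :=
  {x : X // Order.coheight x = 1}

/-- Real Weil divisors on a noetherian scheme: finite real combinations of prime divisors. The
order is the coefficientwise one, so `0 ≤ D` says that `D` is effective. -/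
abbrev RDivisor (X : Scheme.{u}) : Type u :=
  PrimeDivisor X →₀ ℝ

/-- Integral Weil divisors on a noetherian scheme. -/
abbrev ZDivisor (X : Scheme.{u}) : Type u :=
  PrimeDivisor X →₀ ℤ

/-- The round-down of a real divisor. -/
def RDivisor.floor {X : Scheme.{u}} (D : RDivisor X) : ZDivisor X :=
  D.mapRange Int.floor Int.floor_zero

/-- In a normal locally noetherian scheme, the local rings at the points of codimension one are
discrete valuation rings. -/
theorem isDiscreteValuationRing_stalk (X : Scheme.{u}) [IsLocallyNoetherian X]
    [IsNormalScheme X] (P : PrimeDivisor X) :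
    IsDiscreteValuationRing (X.presheaf.stalk P.1) := by
  have hdim : ringKrullDim (X.presheaf.stalk P.1) = 1 := by
    rw [ringKrullDim_stalk_eq_coheight, P.2]; rfl
  have hle : Ring.KrullDimLE 1 (X.presheaf.stalk P.1) := krullDimLE_of_coheight_le P.2.le
  have hf : ¬ IsField (X.presheaf.stalk P.1) := by
    intro h
    have := ringKrullDim_eq_zero_of_isField h
    rw [hdim] at this
    exact one_ne_zero this
  have : Ring.DimensionLEOne (X.presheaf.stalk P.1) :=
    ⟨fun {I} hI0 hI => Ring.krullDimLE_one_iff_of_noZeroDivisors.mp hle I hI0 hI⟩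
  have : IsDedekindDomain (X.presheaf.stalk P.1) :=
    { (inferInstance : IsDomain (X.presheaf.stalk P.1)), (inferInstance :
        IsNoetherianRing (X.presheaf.stalk P.1)), this,
        (inferInstance : IsIntegrallyClosed (X.presheaf.stalk P.1)) with }
  exact ((IsDiscreteValuationRing.TFAE _ hf).out 0 2).mpr this

theorem floor_nonneg {Y : Scheme.{u}} {p : ℕ} (hp : p.Prime) (e : ℕ) {Δ : RDivisor Y} (hΔ : 0 ≤ Δ) :
    0 ≤ RDivisor.floor (((p : ℝ) ^ e - 1) • Δ) := by
  intro P
  have h1 : (1 : ℝ) ≤ (p : ℝ) ^ e := one_le_pow₀ (by exact_mod_cast hp.one_le)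
  have h2 : 0 ≤ Δ P := hΔ P
  exact Int.floor_nonneg.mpr (mul_nonneg (sub_nonneg.mpr h1) h2)

section Sections

variable {Y : Scheme.{u}} [IsIntegral Y] [IsLocallyNoetherian Y] [IsNormalScheme Y]

/-- The sections of `𝒪_Y(E)` over a nonempty open `U`: the rational functions `f` such that
`f = 0`, or `div f + E` is effective on `U`. -/
def sectionsO (E : ZDivisor Y) (U : Y.Opens) [Nonempty U] :
    Submodule Γ(Y, U) Y.functionField where
  carrier := {f | f ≠ 0 → ∀ P : PrimeDivisor Y, P.1 ∈ U → 0 ≤ Y.ord f P.1 + E P}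
  zero_mem' h := absurd rfl h
  add_mem' {f g} hf hg hfg P hP := by
    have := isDiscreteValuationRing_stalk Y P
    have h := Scheme.ord_add (x := P.1) hfg
    by_cases hf0 : f = 0
    · subst hf0
      rw [zero_add] at hfg ⊢
      exact hg hfg P hP
    by_cases hg0 : g = 0
    · subst hg0
      rw [add_zero] at hfg ⊢
      exact hf hfg P hP
    have h1 := hf hf0 P hP
    have h2 := hg hg0 P hP
    rcases min_le_iff.mp h with h | h <;> omega
  smul_mem' a f hf haf P hP := by
    have ha : a ≠ 0 := by rintro rfl; simp at haf
    have hf0 : f ≠ 0 := by rintro rfl; simp at haf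
    have h1 := hf hf0 P hP
    have h2 := Scheme.ord_le_smul hP ha f
    omega

/-- Restriction of sections of `𝒪_Y(E)`. -/
def resO (E : ZDivisor Y) {U V : Y.Opens} [Nonempty U] [Nonempty V] (h : V ≤ U)
    (f : sectionsO E U) : sectionsO E V :=
  ⟨f.1, fun hf P hP => f.2 hf P (h hP)⟩

/-- For `E` effective, the composition
`Γ(U, 𝒪_Y) → Γ(U, F^e_* 𝒪_Y) → Γ(U, F^e_* 𝒪_Y(E))` of the `e`-th power of the Frobenius, which
sends `a` to `a ^ (p ^ e)`, and the natural inclusion. -/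
def frobeniusO (p e : ℕ) {E : ZDivisor Y} (hE : 0 ≤ E) (U : Y.Opens) [Nonempty U]
    (a : Γ(Y, U)) : sectionsO E U :=
  ⟨Y.germToFunctionField U (a ^ p ^ e), fun hf P hP => by
    have ha : a ^ p ^ e ≠ 0 := by
      intro h
      rw [h, map_zero] at hf
      exact hf rfl
    have h1 := Scheme.ord_le_smul hP ha (1 : Y.functionField)
    have h2 : Y.ord 1 P.1 = 0 := by
      have := Scheme.ord_of_isUnit (X := Y) (U := U) (f := 1) isUnit_one hP
      rwa [map_one] at this
    have h3 : (a ^ p ^ e) • (1 : Y.functionField) = Y.germToFunctionField U (a ^ p ^ e) := by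
      rw [Algebra.smul_def, mul_one]; rfl
    rw [h3, h2] at h1
    have h4 : 0 ≤ E P := hE P
    omega⟩

/-- The natural map `𝒪_Y → F^e_* 𝒪_Y(E)` splits as a homomorphism of `𝒪_Y`-modules: there is a
homomorphism of sheaves `φ : F^e_* 𝒪_Y(E) → 𝒪_Y`, where `a` acts on `F^e_* 𝒪_Y(E)` as
multiplication by `a ^ (p ^ e)`, whose composition with the natural map is the identity. -/
def FrobeniusSplits (p e : ℕ) {E : ZDivisor Y} (hE : 0 ≤ E) : Prop :=
  ∃ φ : ∀ (U : Y.Opens) [Nonempty U], sectionsO E U →+ Γ(Y, U),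
    (∀ (U V : Y.Opens) [Nonempty U] [Nonempty V] (h : V ≤ U) (f : sectionsO E U),
      φ V (resO E h f) = Y.presheaf.map (homOfLE h).op (φ U f)) ∧
    (∀ (U : Y.Opens) [Nonempty U] (a : Γ(Y, U)) (f : sectionsO E U),
      φ U (a ^ p ^ e • f) = a * φ U f) ∧
    (∀ (U : Y.Opens) [Nonempty U] (a : Γ(Y, U)), φ U (frobeniusO p e hE U a) = a)

/-- The pair `(Y, Δ)` is globally `F`-split: `Δ` is effective and
`𝒪_Y → F^e_* 𝒪_Y(⌊(p ^ e - 1) Δ⌋)` splits for every `e > 0`. -/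
def IsGloballyFSplit (p : ℕ) [hp : Fact p.Prime] (Y : Scheme.{u}) [IsIntegral Y]
    [IsLocallyNoetherian Y] [IsNormalScheme Y] (Δ : RDivisor Y) : Prop :=
  ∃ hΔ : 0 ≤ Δ, ∀ e : ℕ, 0 < e → FrobeniusSplits p e (floor_nonneg hp.out e hΔ)

end Sections

section Local

variable (X : Scheme.{u})

/-- `Spec R` is normal if `R` is an integrally closed domain. -/
instance isNormalScheme_Spec (R : CommRingCat.{u}) [IsDomain R] [IsIntegrallyClosed R] :
    IsNormalScheme (Spec R) where
  isDomain_stalk x := inferInstance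
  isIntegrallyClosed_stalk x := by
    have hx : x.asIdeal.IsPrime := PrimeSpectrum.isPrime x
    let k : Algebra R ((Spec R).presheaf.stalk x) := StructureSheaf.stalkAlgebra R x
    have : IsLocalization.AtPrime ((Spec R).presheaf.stalk x) x.asIdeal :=
      StructureSheaf.IsLocalization.to_stalk R x
    exact isIntegrallyClosed_of_isLocalization (R := R) _ x.asIdeal.primeCompl
      x.asIdeal.primeCompl_le_nonZeroDivisors

theorem fromSpecStalk_le_iff (x : X) (y z : Spec (X.presheaf.stalk x)) :
    X.fromSpecStalk x y ≤ X.fromSpecStalk x z ↔ y ≤ z :=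
  (X.fromSpecStalk x).isEmbedding.isInducing.specializes_iff

/-- `Spec 𝒪_{X, x} ⟶ X` preserves codimensions. -/
theorem coheight_fromSpecStalk (x : X) (y : Spec (X.presheaf.stalk x)) :
    Order.coheight (X.fromSpecStalk x y) = Order.coheight y := by
  refine (Order.coheight_eq_of_strictMono (X.fromSpecStalk x) ?_ ?_ y).symm
  · exact fun a b h => lt_iff_le_not_ge.mpr
      ⟨(fromSpecStalk_le_iff X x a b).mpr h.le,
        fun h' => h.not_ge ((fromSpecStalk_le_iff X x b a).mp h')⟩
  · intro a b h
    have hb : b ⤳ x := by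
      have h1 : b ⤳ X.fromSpecStalk x a := h.le
      have h2 : X.fromSpecStalk x a ∈ Set.range (X.fromSpecStalk x) := ⟨a, rfl⟩
      rw [Scheme.range_fromSpecStalk] at h2
      exact h1.trans h2
    obtain ⟨c, rfl⟩ : b ∈ Set.range (X.fromSpecStalk x) := by
      rw [Scheme.range_fromSpecStalk]; exact hb
    exact ⟨c, lt_iff_le_not_ge.mpr ⟨(fromSpecStalk_le_iff X x a c).mp h.le,
      fun h' => h.not_ge ((fromSpecStalk_le_iff X x c a).mpr h')⟩, rfl⟩

/-- The prime divisors of `Spec 𝒪_{X, x}` are the prime divisors of `X` through `x`. -/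
def primeDivisorMap (x : X) (P : PrimeDivisor (Spec (X.presheaf.stalk x))) : PrimeDivisor X :=
  ⟨X.fromSpecStalk x P.1, (coheight_fromSpecStalk X x P.1).trans P.2⟩

theorem primeDivisorMap_injective (x : X) : Function.Injective (primeDivisorMap X x) :=
  fun P Q h => by
    have h' : X.fromSpecStalk x P.1 = X.fromSpecStalk x Q.1 := by
      simpa only [primeDivisorMap, Subtype.mk.injEq] using h
    exact Subtype.ext ((X.fromSpecStalk x).isEmbedding.injective h')

variable {X}

/-- The restriction of a divisor to `Spec 𝒪_{X, x}`. -/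
def RDivisor.restrictStalk (Δ : RDivisor X) (x : X) : RDivisor (Spec (X.presheaf.stalk x)) :=
  Δ.comapDomain (primeDivisorMap X x) (primeDivisorMap_injective X x).injOn

/-- The pair `(X, Δ)` is `F`-pure: `Δ` is effective and `(Spec 𝒪_{X, x}, Δ|_{Spec 𝒪_{X, x}})` is
globally `F`-split for every point `x`. -/
def IsFPure (p : ℕ) [Fact p.Prime] (X : Scheme.{u}) [IsLocallyNoetherian X] [IsNormalScheme X]
    (Δ : RDivisor X) : Prop :=
  0 ≤ Δ ∧ ∀ x : X, IsGloballyFSplit p (Spec (X.presheaf.stalk x)) (Δ.restrictStalk x)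

/-- The `F`-pure threshold of `(X, Δ)` with respect to `D`, the supremum in `[0, ∞]` of the
real numbers `t ≥ 0` such that `(X, Δ + t D)` is `F`-pure. -/
def fpt (p : ℕ) [Fact p.Prime] (X : Scheme.{u}) [IsLocallyNoetherian X] [IsNormalScheme X]
    (Δ D : RDivisor X) : ℝ≥0∞ :=
  sSup {c : ℝ≥0∞ | ∃ t : ℝ≥0, IsFPure p X (Δ + (t : ℝ) • D) ∧ c = t}

end Local

end FSing

end

/-!
The set of `t` such that `(X, Δ + t D)` is `F`-pure is controlled by two observations, both of
which work directly with the rational functions that are the sections of `𝒪_Y(E)`.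

*Attainment of the supremum* (`FSing.isFPure_add_smul_of_le`). If `p ^ n • E ≤ G`, then
`f ↦ f ^ (p ^ n)` maps `𝒪_Y(E)` into `𝒪_Y(G)`, so a splitting of
`𝒪_Y → F^{e+n}_* 𝒪_Y(G)` induces one of `𝒪_Y → F^e_* 𝒪_Y(E)` (`FSing.FrobeniusSplits.descend`).
Put `q = p ^ e`, `E = ⌊(q - 1)(Δ + c D)⌋` and `G = ⌊(q ^ 2 - 1)(Δ + t D)⌋`. Then `q • E ≤ G` as soon
as `q c ≤ (q + 1) t`: the round-down does no harm because `q (q - 1) < q ^ 2 - 1`. For fixed `e` this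
inequality leaves room for some `t < c` if `c > 0`, and such a `t` with `(X, Δ + t D)` `F`-pure exists
if `c` is the supremum.

*Finiteness* (`FSing.exists_bound_of_isFPure`). Let `D` have a positive coefficient at a prime
divisor `P`, and let `ϖ` be a uniformizer of the discrete valuation ring `𝒪_{X, P}`. If `t` is
large, then `ϖ ^ (-p)` is a section of `𝒪(⌊(p - 1)(Δ + t D)⌋)` on `Spec 𝒪_{X, P}`, and a splitting
`φ` would give `1 = φ(1) = φ(ϖ ^ p · ϖ ^ (-p)) = ϖ φ(ϖ ^ (-p))`
(`FSing.not_frobeniusSplits_of_not_isUnit`).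
-/

namespace FSing

/-! ### Orders of powers and inverses of rational functions -/

section Order

variable {Y : Scheme.{u}} [IsIntegral Y] [IsLocallyNoetherian Y]

theorem ord_one (x : Y) : Y.ord 1 x = 0 := by
  have h := Scheme.ord_mul (x := x) (one_ne_zero (α := Y.functionField)) one_ne_zero
  rw [one_mul] at h
  omega

theorem ord_pow {f : Y.functionField} (hf : f ≠ 0) (n : ℕ) (x : Y) :
    Y.ord (f ^ n) x = n * Y.ord f x := by
  induction n with
  | zero => simp [ord_one]
  | succ n ih =>
    rw [pow_succ, Scheme.ord_mul (pow_ne_zero n hf) hf, ih]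
    push_cast
    ring

theorem ord_inv {f : Y.functionField} (hf : f ≠ 0) (x : Y) : Y.ord f⁻¹ x = -Y.ord f x := by
  have h := Scheme.ord_mul (x := x) hf (inv_ne_zero hf)
  rw [mul_inv_cancel₀ hf, ord_one] at h
  omega

end Order

/-! ### Splittings of the Frobenius twisted by a divisor -/

section Splitting

variable {Y : Scheme.{u}} [IsIntegral Y] [IsLocallyNoetherian Y] [IsNormalScheme Y]

theorem pow_mem_sectionsO {E G : ZDivisor Y} {q : ℕ} (hEG : q • E ≤ G) {U : Y.Opens} [Nonempty U]
    (hq : q ≠ 0) {f : Y.functionField} (hf : f ∈ sectionsO E U) : f ^ q ∈ sectionsO G U := by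
  intro hfq P hP
  have hf0 : f ≠ 0 := fun h => hfq (by rw [h, zero_pow hq])
  have h1 : 0 ≤ Y.ord f P.1 + E P := hf hf0 P hP
  have h2 : (q : ℤ) * E P ≤ G P := by simpa using hEG P
  rw [ord_pow hf0]
  have h3 : 0 ≤ (q : ℤ) * (Y.ord f P.1 + E P) := mul_nonneg (Int.natCast_nonneg q) h1
  linarith

/-- If `p ^ n • E ≤ G`, then `𝒪_Y → F^{e+n}_* 𝒪_Y(G)` factors through `𝒪_Y → F^e_* 𝒪_Y(E)`, via the
map `f ↦ f ^ (p ^ n)`, so that a splitting of the former gives one of the latter. -/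
theorem FrobeniusSplits.descend {p : ℕ} [Fact p.Prime] (hp : (p : Y.functionField) = 0) {e n : ℕ}
    {E G : ZDivisor Y} {hE : 0 ≤ E} {hG : 0 ≤ G} (hEG : p ^ n • E ≤ G)
    (h : FrobeniusSplits p (e + n) hG) : FrobeniusSplits p e hE := by
  have : CharP Y.functionField p := (CharP.charP_iff_prime_eq_zero Fact.out).mpr hp
  have hpn : p ^ n ≠ 0 := pow_ne_zero n (Fact.out : p.Prime).ne_zero
  obtain ⟨φ, hres, hsmul, hone⟩ := h
  refine ⟨fun U _ => (φ U).comp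
    { toFun := fun f => ⟨f.1 ^ p ^ n, pow_mem_sectionsO hEG hpn f.2⟩
      map_zero' := Subtype.ext (zero_pow hpn)
      map_add' := fun f g => Subtype.ext (add_pow_char_pow f.1 g.1 p n) }, ?_, ?_, ?_⟩
  · intro U V _ _ hVU f
    exact hres U V hVU ⟨f.1 ^ p ^ n, pow_mem_sectionsO hEG hpn f.2⟩
  · intro U _ a f
    refine Eq.trans (congrArg (φ U) (Subtype.ext ?_))
      (hsmul U a ⟨f.1 ^ p ^ n, pow_mem_sectionsO hEG hpn f.2⟩)
    change (a ^ p ^ e • f.1) ^ p ^ n = a ^ p ^ (e + n) • f.1 ^ p ^ n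
    rw [smul_pow, ← pow_mul, ← pow_add]
  · intro U _ a
    refine Eq.trans (congrArg (φ U) (Subtype.ext ?_)) (hone U a)
    change (Y.germToFunctionField U (a ^ p ^ e)) ^ p ^ n =
      Y.germToFunctionField U (a ^ p ^ (e + n))
    rw [← map_pow, ← pow_mul, ← pow_add]

/-- A global function `a ≠ 0` that is not invertible obstructs a splitting as soon as
`E ≥ p ^ e • div a`: the section `a ^ (-p ^ e)` would be mapped to an inverse of `a`. -/
theorem not_frobeniusSplits_of_not_isUnit {p e : ℕ} [Nonempty (⊤ : Y.Opens)] {E : ZDivisor Y}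
    {hE : 0 ≤ E} {a : Γ(Y, ⊤)} (ha0 : a ≠ 0) (ha : ¬ IsUnit a)
    (haE : ∀ P : PrimeDivisor Y,
      (p ^ e : ℕ) * Y.ord (Y.germToFunctionField ⊤ a) P.1 ≤ E P) :
    ¬ FrobeniusSplits p e hE := by
  rintro ⟨φ, -, hsmul, hone⟩
  set b : Y.functionField := Y.germToFunctionField ⊤ a with hb
  have hb0 : b ≠ 0 := fun h => ha0
    (Y.germToFunctionField_injective ⊤ (by rw [← hb, h, map_zero]))
  have hmem : (b ^ p ^ e)⁻¹ ∈ sectionsO E (⊤ : Y.Opens) := by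
    intro _ P _
    rw [ord_inv (pow_ne_zero _ hb0), ord_pow hb0]
    have := haE P
    linarith
  refine ha (IsUnit.of_mul_eq_one (φ ⊤ ⟨_, hmem⟩) ?_)
  rw [← hsmul ⊤ a ⟨_, hmem⟩, ← hone ⊤ 1]
  refine congrArg (φ ⊤) (Subtype.ext ?_)
  change a ^ p ^ e • (b ^ p ^ e)⁻¹ = Y.germToFunctionField ⊤ (1 ^ p ^ e)
  rw [one_pow, map_one, Algebra.smul_def, map_pow]
  exact mul_inv_cancel₀ (pow_ne_zero _ hb0)

end Splitting

/-! ### Spectra of the local rings -/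

section Stalk

variable {X : Scheme.{u}}

theorem natCast_functionField_Spec_stalk [IsNormalScheme X] {p : ℕ}
    (hp : IsOfCharacteristic p X) (x : X) :
    (p : (Spec (X.presheaf.stalk x)).functionField) = 0 := by
  have h1 : (p : X.presheaf.stalk x) = 0 := by
    rw [← map_natCast (X.presheaf.germ ⊤ x trivial).hom p]
    exact (congrArg _ hp).trans (map_zero _)
  have h2 : (p : Γ(Spec (X.presheaf.stalk x), ⊤)) = 0 := by
    rw [← map_natCast (Scheme.ΓSpecIso (X.presheaf.stalk x)).inv.hom p, h1, map_zero]
  have : Nonempty (⊤ : (Spec (X.presheaf.stalk x)).Opens) :=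
    ⟨⟨IsLocalRing.closedPoint _, trivial⟩⟩
  rw [← map_natCast ((Spec (X.presheaf.stalk x)).germToFunctionField ⊤).hom p, h2, map_zero]

theorem restrictStalk_add_smul_apply (Δ D : RDivisor X) (t : ℝ) (x : X)
    (Q : PrimeDivisor (Spec (X.presheaf.stalk x))) :
    (Δ + t • D).restrictStalk x Q =
      Δ (primeDivisorMap X x Q) + t * D (primeDivisorMap X x Q) := rfl

theorem restrictStalk_nonneg {Δ : RDivisor X} (hΔ : 0 ≤ Δ) (x : X) : 0 ≤ Δ.restrictStalk x :=
  fun Q => hΔ (primeDivisorMap X x Q)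

/-- The only prime divisor through a point of codimension one is the closure of that point. -/
theorem primeDivisorMap_eq (P : PrimeDivisor X)
    (Q : PrimeDivisor (Spec (X.presheaf.stalk P.1))) : primeDivisorMap X P.1 Q = P := by
  -- `Q` is a generization of `P`, and it cannot be a proper one since both have codimension one.
  have hle : P.1 ≤ X.fromSpecStalk P.1 Q.1 := by
    have h : X.fromSpecStalk P.1 Q.1 ∈ Set.range (X.fromSpecStalk P.1) := ⟨_, rfl⟩
    rwa [Scheme.range_fromSpecStalk] at h
  have hnlt : ¬ P.1 < X.fromSpecStalk P.1 Q.1 := by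
    intro hlt
    have hξ : Order.coheight (X.fromSpecStalk P.1 Q.1) = 1 := (primeDivisorMap X P.1 Q).2
    have h := Order.coheight_strictAnti hlt (by rw [hξ]; exact ENat.natCast_lt_top 1)
    rw [P.2, hξ] at h
    exact lt_irrefl _ h
  have hge : X.fromSpecStalk P.1 Q.1 ≤ P.1 := by
    by_contra h
    exact hnlt (lt_iff_le_not_ge.mpr ⟨hle, h⟩)
  exact Subtype.ext (Specializes.antisymm (y := P.1) hle hge).eq

end Stalk

/-! ### Attainment of the threshold -/

section Threshold

variable {p : ℕ} [Fact p.Prime] {X : Scheme.{u}} [IsLocallyNoetherian X] [IsNormalScheme X]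
  {Δ D : RDivisor X}

/-- The estimate behind the attainment of the supremum: with `q = p ^ e`, the coefficients `y` of
`Δ + t D` may be smaller than the coefficients `x` of `Δ + c D` by a factor of `q / (q + 1)`. -/
theorem mul_floor_le_floor {q : ℕ} (hq : 1 ≤ q) {x y : ℝ} (h : q * x ≤ (q + 1) * y) :
    (q : ℤ) * ⌊((q : ℝ) - 1) * x⌋ ≤ ⌊((q : ℝ) * q - 1) * y⌋ := by
  have hq1 : (1 : ℝ) ≤ q := by exact_mod_cast hq
  rw [Int.le_floor]
  push_cast
  calc (q : ℝ) * ⌊((q : ℝ) - 1) * x⌋ ≤ q * (((q : ℝ) - 1) * x) :=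
        mul_le_mul_of_nonneg_left (Int.floor_le _) (by linarith)
    _ = (q - 1) * (q * x) := by ring
    _ ≤ (q - 1) * ((q + 1) * y) := mul_le_mul_of_nonneg_left h (by linarith)
    _ = ((q : ℝ) * q - 1) * y := by ring

/-- If `(X, Δ + t D)` is `F`-pure for `t` relatively close to `c`, then so is `(X, Δ + c D)`. The
closeness needed depends on the power of the Frobenius under consideration. -/
theorem isFPure_add_smul_of_le (hp : IsOfCharacteristic p X) (hΔ : 0 ≤ Δ) (hD : 0 ≤ D) {c : ℝ}
    (hc : 0 ≤ c)
    (h : ∀ q : ℕ, ∃ t : ℝ, IsFPure p X (Δ + t • D) ∧ q * c ≤ (q + 1) * t) :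
    IsFPure p X (Δ + c • D) := by
  have hnonneg : 0 ≤ Δ + c • D := add_nonneg hΔ (smul_nonneg hc hD)
  refine ⟨hnonneg, fun x => ⟨restrictStalk_nonneg hnonneg x, fun e he => ?_⟩⟩
  obtain ⟨t, ht, htc⟩ := h (p ^ e)
  obtain ⟨_, hsplit⟩ := ht.2 x
  refine (hsplit (e + e) (by omega)).descend (natCast_functionField_Spec_stalk hp x) fun Q => ?_
  have hΔQ : 0 ≤ Δ (primeDivisorMap X x Q) := hΔ _
  have hDQ : 0 ≤ D (primeDivisorMap X x Q) := hD _
  have key := mul_floor_le_floor (q := p ^ e) (x := (Δ + c • D).restrictStalk x Q)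
    (y := (Δ + t • D).restrictStalk x Q) (Nat.one_le_pow _ _ (Fact.out : p.Prime).pos) (by
      rw [restrictStalk_add_smul_apply, restrictStalk_add_smul_apply]
      have := mul_le_mul_of_nonneg_right htc hDQ
      linarith)
  simpa [RDivisor.floor, pow_add] using key

/-! ### Finiteness of the threshold -/

/-- If `D ≠ 0`, then the `t` for which `(X, Δ + t D)` is `F`-pure are bounded. The obstruction comes
from the local ring at a prime divisor in the support of `D`, and from the first power of the
Frobenius. -/
theorem exists_bound_of_isFPure (hΔ : 0 ≤ Δ) (hD : 0 ≤ D) (hD0 : D ≠ 0) :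
    ∃ B : ℝ≥0, ∀ t : ℝ≥0, IsFPure p X (Δ + (t : ℝ) • D) → t ≤ B := by
  obtain ⟨P, hP⟩ := Finsupp.ne_iff.mp hD0
  have hDP : 0 < D P := lt_of_le_of_ne (hD P) (Ne.symm hP)
  have hΔP : 0 ≤ Δ P := hΔ P
  have := isDiscreteValuationRing_stalk X P
  obtain ⟨ϖ, hϖ⟩ := IsDiscreteValuationRing.exists_irreducible (X.presheaf.stalk P.1)
  set Y := Spec (X.presheaf.stalk P.1)
  have : Nonempty (⊤ : Y.Opens) := ⟨⟨IsLocalRing.closedPoint _, trivial⟩⟩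
  let i := (Scheme.ΓSpecIso (X.presheaf.stalk P.1)).symm.commRingCatIsoToRingEquiv
  have ha0 : i ϖ ≠ 0 := (map_ne_zero_iff i i.injective).mpr hϖ.ne_zero
  have ha : ¬ IsUnit (i ϖ) := fun h => hϖ.not_isUnit ((MulEquiv.isUnit_map i).mp h)
  let v : PrimeDivisor Y → ℤ := fun Q => Y.ord (Y.germToFunctionField ⊤ (i ϖ)) Q.1
  -- `Y` has a single prime divisor, so that the order of `ϖ` is bounded.
  obtain ⟨m, hm⟩ : ∃ m : ℕ, ∀ Q, v Q ≤ m := by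
    by_cases hne : Nonempty (PrimeDivisor Y)
    · obtain ⟨Q₀⟩ := hne
      refine ⟨(v Q₀).toNat, fun Q => ?_⟩
      rw [primeDivisorMap_injective X P.1
        ((primeDivisorMap_eq P Q).trans (primeDivisorMap_eq P Q₀).symm)]
      exact Int.self_le_toNat _
    · exact ⟨0, fun Q => (hne ⟨Q⟩).elim⟩
  refine ⟨(p * m / D P).toNNReal, fun t ht => ?_⟩
  by_contra! hlt
  have hlt' : (p * m / D P : ℝ) < t := (Real.toNNReal_lt_iff_lt_coe (by positivity)).mp hlt
  obtain ⟨_, hsplit⟩ := ht.2 P.1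
  refine not_frobeniusSplits_of_not_isUnit ha0 ha (fun Q => ?_) (hsplit 1 one_pos)
  have hp2 : (2 : ℝ) ≤ p := by exact_mod_cast (Fact.out : p.Prime).two_le
  change ((p ^ 1 : ℕ) : ℤ) * v Q ≤ ⌊((p : ℝ) ^ 1 - 1) * (Δ + (t : ℝ) • D).restrictStalk P.1 Q⌋
  rw [restrictStalk_add_smul_apply, primeDivisorMap_eq, Int.le_floor]
  have h1 : (p * m : ℝ) < t * D P := (div_lt_iff₀ hDP).mp hlt'
  have h2 : (v Q : ℝ) ≤ m := by exact_mod_cast hm Q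
  have h3 : (p : ℝ) * v Q ≤ p * m := mul_le_mul_of_nonneg_left h2 (by linarith)
  have h4 : 0 ≤ (t : ℝ) * D P := mul_nonneg t.2 hDP.le
  have h5 : 0 ≤ ((p : ℝ) - 2) * (Δ P + t * D P) :=
    mul_nonneg (by linarith) (by linarith)
  push_cast
  rw [pow_one]
  linarith

end Threshold

end FSing

theorem mainTheorem4 (p : ℕ) [Fact p.Prime] (X : Scheme.{u}) [IsNoetherian X]
    [FSing.IsNormalScheme X] (hp : FSing.IsOfCharacteristic p X) (hF : FSing.IsFFinite p X)
    (Δ D : FSing.RDivisor X) (hΔ : FSing.IsFPure p X Δ) (hD : 0 ≤ D) :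
    (D ≠ 0 → FSing.fpt p X Δ D ≠ ⊤) ∧
      FSing.IsFPure p X (Δ + (FSing.fpt p X Δ D).toReal • D) := by
  have hfin : D ≠ 0 → FSing.fpt p X Δ D ≠ ⊤ := by
    intro hD0
    obtain ⟨B, hB⟩ := FSing.exists_bound_of_isFPure (p := p) hΔ.1 hD hD0
    refine ne_top_of_le_ne_top (ENNReal.coe_ne_top (r := B)) (sSup_le ?_)
    rintro _ ⟨t, ht, rfl⟩
    exact ENNReal.coe_le_coe.mpr (hB t ht)
  refine ⟨hfin, ?_⟩
  by_cases hD0 : D = 0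
  · rw [hD0, smul_zero, add_zero]
    exact hΔ
  refine FSing.isFPure_add_smul_of_le hp hΔ.1 hD ENNReal.toReal_nonneg fun q => ?_
  set c := FSing.fpt p X Δ D with hc
  have hct : c ≠ ⊤ := hfin hD0
  by_cases hc0 : c = 0
  · refine ⟨0, ?_, by simp [hc0]⟩
    rwa [zero_smul, add_zero]
  have hcpos : 0 < c.toReal := ENNReal.toReal_pos hc0 hct
  -- As `q c / (q + 1) < c`, some admissible `t` exceeds `q c / (q + 1)`.
  have hlt : ENNReal.ofReal (q * c.toReal / (q + 1)) < c := by
    rw [ENNReal.ofReal_lt_iff_lt_toReal (by positivity) hct, div_lt_iff₀ (by positivity)]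
    linarith
  obtain ⟨_, ⟨t, ht, rfl⟩, hlt'⟩ := lt_sSup_iff.mp hlt
  refine ⟨t, ht, ?_⟩
  have h1 : q * c.toReal / (q + 1) ≤ t :=
    (ENNReal.ofReal_le_iff_le_toReal ENNReal.coe_ne_top).mp hlt'.le
  rw [div_le_iff₀ (by positivity)] at h1
  linarith
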